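/- Let $\mathcal U=\mathcal U_{n,m}^r$ be a uni-cyclic multigraph: a finite connected loopless multigraph with $n$ edges (parallel edges counted individually) whose associated simple graph has exactly one cycle, this cycle having length $m$ (so $m\ge 3$), and in which exactly $r$ pairs of vertices are joined by at least two edges; such a pair, with the edges joining it, is called a multiple edge. Let $r'$ of the multiple edges lie on the cycle and $r''$ outside the cycle ($r=r'+r''$). Index the multiple edges on the cycle by $1,\dots,r'$ and those outside by $m+1,\dots,m+r''$, let $t_k\ge 2$ be the number of parallel edges in the $k$-th multiple edge, and put $\alpha=\sum_{k=1}^{r'}t_k$ and $\beta=\sum_{k=m+1}^{m+r''}t_k$. Let $\Delta_s(\mathcal U)$ be the spanning simplicial complex of $\mathcal U$, i.e. the simplicial complex on the edges of $\mathcal U$ generated by the edge sets of the spanning trees of $\mathcal U$; let $f_i$ be the number of its faces with $i+1$ elements, let its dimension be $\max_F(|F|-1)$ over its faces $F$, and let $\chi(\Delta)=\sum_{i=0}^{\dim\Delta}(-1)^if_i$. Binomial coefficients $\binom{a}{b}$ with $b<0$ are $0$. Then $$\dim\Delta_s(\mathcal U)=n-\alpha-\beta+r-2,$$ for every integer $i\ge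 0$ $$\begin{aligned}f_i={}&\binom{n}{i+1}-\prod_{k=1}^{r'}t_k\Bigg[\binom{n-\alpha+r'-m}{i+1-m}\\&\qquad-\sum_{j=2}^{\beta}\Big(\binom{\beta}{j}-\sum_{\substack{S\subseteq\{m+1,\dots,m+r''\}\\|S|=j}}\ \prod_{k\in S}t_k\Big)\sum_{l=j}^{\beta}(-1)^{l-j}\binom{\beta-j}{l-j}\binom{n-\alpha+r'-m-l}{i+1-m-l}\Bigg]\\&-\sum_{j=2}^{\alpha+\beta}\Big(\binom{\alpha+\beta}{j}-\sum_{\substack{S\subseteq\{1,\dots,r'\}\cup\{m+1,\dots,m+r''\}\\|S|=j}}\ \prod_{k\in S}t_k\Big)\sum_{l=j}^{\alpha+\beta}(-1)^{l-j}\binom{\alpha+\beta-j}{l-j}\binom{n-l}{i+1-l},\end{aligned}$$ and $$\chi(\Delta_s(\mathcal U))=\sum_{i=0}^{n-1}(-1)^if_i$$ with each $f_i$ given by this expression. -/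

import Mathlib

namespace Graph

variable {V ε : Type*}

/-- A multigraph is a tree if it is connected and has no cycle. A loop is a cycle of length one and
two parallel edges form a cycle of length two, so a tree is a simple multigraph (no loops, no
parallel edges) whose associated simple graph, on the same vertices, is a tree. -/
def IsTree (T : Graph V ε) : Prop := T.Simple ∧ T.toSimpleGraph.IsTree

/-- `T` is a spanning tree of `G`: a subgraph of `G` that is a tree and contains every vertex. -/
def IsSpanningTree (T G : Graph V ε) : Prop := T.IsSpanningSubgraph G ∧ T.IsTree

/-- The spanning simplicial complex of `G`: the simplicial complex on the edges of `G` generated by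
the edge sets of the spanning trees of `G`. (Mathlib's convention is not to list the empty face.) -/
def spanningComplex (G : Graph V ε) : PreAbstractSimplicialComplex ε where
  faces := {F | F.Nonempty ∧ ∃ T : Graph V ε, T.IsSpanningTree G ∧ (F : Set ε) ⊆ T.edgeSet}
  isRelLowerSet_faces := by
    rintro F ⟨hF, T, hT, hFT⟩
    exact ⟨hF, fun F' hle hF' =>
      ⟨hF', T, hT, (Finset.coe_subset.mpr hle).trans hFT⟩⟩

/-- The set of edges of `G` that join the two vertices of the pair `p`. -/
def bundle (G : Graph V ε) (p : Sym2 G.vertexSet) : Set ε :=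
  {e | ∃ x y : G.vertexSet, p = s(x, y) ∧ G.IsLink e x y}

/-- The multiplicity of the pair `p`: the number of edges of `G` that join its two vertices. -/
noncomputable def mult (G : Graph V ε) (p : Sym2 G.vertexSet) : ℕ := (G.bundle p).ncard

/-- The multiple edges of `G`, each given by its pair of end vertices: the pairs of vertices that
are joined by at least two edges. -/
def multipleEdges (G : Graph V ε) : Set (Sym2 G.vertexSet) := {p | 2 ≤ G.mult p}

/-- The pairs of vertices that are consecutive on some cycle of the associated simple graph. -/
def cyclePairs (G : Graph V ε) : Set (Sym2 G.vertexSet) :=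
  {p | ∃ (v : G.vertexSet) (c : G.toSimpleGraph.Walk v v), c.IsCycle ∧ p ∈ c.edges}

/-- `G` is a uni-cyclic multigraph with `n` edges, `r` multiple edges and a cycle of length `m`:
a connected multigraph without loops with exactly `n` edges, in which exactly `r` pairs of vertices
are joined by more than one edge, and whose associated simple graph has exactly one cycle
(cycles being compared through their edges), the length of which is `m`. -/
structure IsUnicyclicMultigraph (G : Graph V ε) (n r m : ℕ) : Prop where
  loopless : G.Loopless
  connected : G.toSimpleGraph.Connected
  finite : G.edgeSet.Finite
  ncard_edgeSet : G.edgeSet.ncard = n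
  ncard_multipleEdges : G.multipleEdges.ncard = r
  unique_cycle : ∃ (v : G.vertexSet) (c : G.toSimpleGraph.Walk v v), c.IsCycle ∧ c.length = m ∧
    ∀ (w : G.vertexSet) (d : G.toSimpleGraph.Walk w w), d.IsCycle →
      ∀ p : Sym2 G.vertexSet, p ∈ d.edges ↔ p ∈ c.edges

end Graph

namespace PreAbstractSimplicialComplex

variable {ι : Type*}

/-- The dimensions `|F| - 1` of the faces `F` of `K`. -/
def faceDims (K : PreAbstractSimplicialComplex ι) : Set ℤ :=
  {d | ∃ F ∈ K.faces, d = (F.card : ℤ) - 1}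

/-- The dimension of `K`: the largest dimension of a face. -/
noncomputable def dim (K : PreAbstractSimplicialComplex ι) : ℤ := sSup K.faceDims

/-- The face number `f_i`: the number of faces of dimension `i`. -/
noncomputable def faceNumber (K : PreAbstractSimplicialComplex ι) (i : ℕ) : ℕ :=
  {F : Finset ι | F ∈ K.faces ∧ F.card = i + 1}.ncard

/-- The Euler characteristic `∑_{i = 0}^{dim K} (-1)^i f_i`. -/
noncomputable def eulerChar (K : PreAbstractSimplicialComplex ι) : ℤ :=
  ∑ i ∈ Finset.range (K.dim + 1).toNat, (-1) ^ i * (K.faceNumber i : ℤ)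

end PreAbstractSimplicialComplex

namespace SpanningComplexFormula

/-- The binomial coefficient, equal to `0` when the lower index is negative. -/
def binom (a k : ℤ) : ℤ := if 0 ≤ k then Ring.choose a k.toNat else 0

/-- `∑_{i₁ < ... < i_j} t_{i₁} ⋯ t_{i_j}`, over all ways to choose `j` of the indices in `M`. -/
def choiceSum {ι : Type*} (M : Finset ι) (t : ι → ℕ) (j : ℕ) : ℤ :=
  ∑ S ∈ M.powersetCard j, ∏ s ∈ S, (t s : ℤ)

/-- `∑_{j=2}^{p} (C(p,j) - ∑_{i₁<...<i_j} t_{i₁}⋯t_{i_j}) ∑_{l=j}^{p} (-1)^{l-j} C(p-j,l-j) C(N-l,k-l)`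
with `p = ∑_{i ∈ M} t_i`. The subtractions of natural numbers do not truncate, as `j ≤ l ≤ p`. -/
def doubleSum {ι : Type*} (M : Finset ι) (t : ι → ℕ) (N k : ℤ) : ℤ :=
  ∑ j ∈ Finset.Icc 2 (∑ s ∈ M, t s),
    (((∑ s ∈ M, t s).choose j : ℤ) - choiceSum M t j) *
      ∑ l ∈ Finset.Icc j (∑ s ∈ M, t s),
        (-1) ^ (l - j) * (((∑ s ∈ M, t s) - j).choose (l - j) : ℤ) * binom (N - l) (k - l)

open Classical in
/-- The explicit expression for `f_i`, where `M'` and `M''` index the multiple edges within and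
outside the cycle, `t` is the multiplicity, `α = ∑_{s ∈ M'} t s` and `r' = |M'|`. -/
noncomputable def faceFormula {ι : Type*} (n m : ℕ) (M' M'' : Finset ι) (t : ι → ℕ) (i : ℕ) : ℤ :=
  binom n (i + 1)
    - (∏ s ∈ M', (t s : ℤ)) *
        (binom ((n : ℤ) - (∑ s ∈ M', (t s : ℤ)) + M'.card - m) ((i : ℤ) + 1 - m)
          - doubleSum M'' t ((n : ℤ) - (∑ s ∈ M', (t s : ℤ)) + M'.card - m) ((i : ℤ) + 1 - m))
    - doubleSum (M' ∪ M'') t n (i + 1)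

end SpanningComplexFormula

/-!
The faces of the spanning complex are the nonempty forests. In a uni-cyclic multigraph, an edge set
is a forest exactly when it has at most one edge between each pair of vertices and has no edge
between some pair of consecutive vertices of the cycle. Counting forests by the pairs they join,
the number of forests with `k` edges is the elementary symmetric sum of degree `k` of all the
multiplicities, less the part of that sum that comes from the sets containing the whole cycle.

The pairs of multiplicity one do not show up in the explicit formula: their contribution to an
elementary symmetric sum is a binomial coefficient, and replacing `choiceSum M t j` by
`(∑ s ∈ M, t s).choose j` in the resulting convolution turns it, by Vandermonde's identity, into a
single binomial coefficient. The terms with `j = 0` and `j = 1` of the two sums agree, which is why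
`doubleSum` starts at `j = 2`.
-/

namespace SpanningComplexFormula

open Finset

/-! ### The explicit formula as a difference of symmetric sums -/

lemma binom_natCast (a k : ℕ) : binom a k = a.choose k := by
  rw [binom, if_pos k.cast_nonneg, Int.toNat_natCast, Ring.choose_natCast]

lemma binom_of_neg (a : ℤ) {k : ℤ} (hk : k < 0) : binom a k = 0 := if_neg hk.not_ge

lemma binom_add_one (a k : ℤ) : binom (a + 1) k = binom a k + binom a (k - 1) := by
  rcases lt_or_ge k 0 with hk | hk
  · simp only [binom_of_neg _ hk, binom_of_neg _ (show k - 1 < 0 by lia), add_zero]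
  lift k to ℕ using hk
  rcases k with _ | k
  · simp [binom]
  · simp [binom, Ring.choose_succ_succ, add_comm, show (0 : ℤ) ≤ k + 1 by lia]

lemma sum_choose_mul_binom (a : ℕ) (N k : ℤ) :
    ∑ i ∈ range (a + 1), (a.choose i : ℤ) * binom N (k - i) = binom (N + a) k := by
  induction a generalizing k with
  | zero => simp
  | succ a ih =>
    rw [sum_choose_succ_mul fun i _ => binom N (k - i), ih, Nat.cast_add_one, ← add_assoc,
      binom_add_one, ← ih (k - 1)]
    simp only [Nat.cast_add_one, sub_sub, add_comm (1 : ℤ)]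

lemma sum_alternating_choose_mul_binom (a : ℕ) (N k : ℤ) :
    ∑ i ∈ range (a + 1), (a.choose i : ℤ) * ((-1) ^ i * binom (N - i) (k - i))
      = binom (N - a) k := by
  induction a generalizing N k with
  | zero => simp
  | succ a ih =>
    have shifted : ∑ i ∈ range (a + 1),
        (a.choose i : ℤ) * ((-1) ^ (i + 1) * binom (N - ↑(i + 1)) (k - ↑(i + 1)))
          = -binom (N - 1 - a) (k - 1) := by
      rw [← ih, ← sum_neg_distrib]
      refine sum_congr rfl fun i _ => ?_
      rw [Nat.cast_add_one, add_comm (i : ℤ), ← sub_sub, ← sub_sub]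
      ring
    rw [sum_choose_succ_mul fun i _ => (-1) ^ i * binom (N - i) (k - i), ih, shifted,
      ← sub_eq_add_neg, sub_eq_iff_eq_add, show N - a = N - ↑(a + 1) + 1 by push_cast; ring,
      binom_add_one, sub_right_comm, sub_sub, Nat.cast_add_one]

section FaceFormula

variable {ι : Type*}

lemma choiceSum_zero (M : Finset ι) (t : ι → ℕ) : choiceSum M t 0 = 1 := by
  simp [choiceSum]

lemma choiceSum_one (M : Finset ι) (t : ι → ℕ) : choiceSum M t 1 = ∑ s ∈ M, (t s : ℤ) := by
  simp [choiceSum, powersetCard_one]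

lemma choiceSum_of_card_lt {M : Finset ι} (t : ι → ℕ) {j : ℕ} (hj : #M < j) :
    choiceSum M t j = 0 := by
  rw [choiceSum, powersetCard_eq_empty.2 hj, sum_empty]

lemma choiceSum_of_forall_eq_one {M : Finset ι} {t : ι → ℕ} (ht : ∀ s ∈ M, t s = 1) (k : ℕ) :
    choiceSum M t k = (#M).choose k := by
  have prod_eq_one (S) (hS : S ∈ M.powersetCard k) : ∏ s ∈ S, (t s : ℤ) = 1 :=
    Finset.prod_eq_one fun s hs => by
      rw [ht s ((mem_powersetCard.1 hS).1 hs), Nat.cast_one]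
  rw [choiceSum, sum_congr rfl prod_eq_one, sum_const, card_powersetCard, nsmul_one]

open Polynomial in
lemma choiceSum_eq_coeff_prod (M : Finset ι) (t : ι → ℕ) (k : ℕ) :
    choiceSum M t k = (∏ s ∈ M, (1 + C (t s : ℤ) * X)).coeff k := by
  rw [prod_one_add, finsetSum_coeff, choiceSum, powersetCard_eq_filter, sum_filter]
  refine sum_congr rfl fun S _ => ?_
  rw [prod_mul_distrib, prod_const, ← map_prod, coeff_C_mul_X_pow]
  simp only [eq_comm]

open Polynomial in
lemma choiceSum_union [DecidableEq ι] {M L : Finset ι} (h : Disjoint M L) (t : ι → ℕ) (k : ℕ) :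
    choiceSum (M ∪ L) t k
      = ∑ x ∈ antidiagonal k, choiceSum M t x.1 * choiceSum L t x.2 := by
  simp only [choiceSum_eq_coeff_prod, prod_union h, coeff_mul]

lemma doubleSum_eq_sum_binom (M : Finset ι) (t : ι → ℕ) (N k : ℤ) :
    doubleSum M t N k = ∑ j ∈ range (∑ s ∈ M, t s + 1),
      (((∑ s ∈ M, t s).choose j : ℤ) - choiceSum M t j) * binom (N - ∑ s ∈ M, t s) (k - j) := by
  rw [doubleSum]
  set p := ∑ s ∈ M, t s with hp
  have inner (j) (hj : j ∈ Icc 2 p) : ∑ l ∈ Icc j p,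
      (-1) ^ (l - j) * ((p - j).choose (l - j) : ℤ) * binom (N - l) (k - l)
        = binom (N - p) (k - j) := by
    obtain ⟨a, ha⟩ := Nat.exists_eq_add_of_le (mem_Icc.1 hj).2
    rw [← Ico_add_one_right_eq_Icc, sum_Ico_eq_sum_range, ha, add_assoc, Nat.add_sub_cancel_left,
      Nat.add_sub_cancel_left, Nat.cast_add, ← sub_sub, ← sum_alternating_choose_mul_binom]
    refine sum_congr rfl fun i _ => ?_
    rw [Nat.add_sub_cancel_left, Nat.cast_add, sub_sub, sub_sub]
    ring
  rw [sum_congr rfl fun j hj => by rw [inner j hj]]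
  refine sum_subset (fun j hj => ?_) fun j hj hj' => ?_
  · rw [mem_range, Nat.lt_succ_iff]
    exact (mem_Icc.1 hj).2
  · obtain rfl | rfl : j = 0 ∨ j = 1 := by
      rw [mem_range] at hj
      rw [mem_Icc] at hj'
      lia
    · rw [choiceSum_zero, Nat.choose_zero_right, Nat.cast_one, sub_self, zero_mul]
    · rw [choiceSum_one, Nat.choose_one_right, hp, Nat.cast_sum, sub_self, zero_mul]

lemma binom_sub_doubleSum (M : Finset ι) (t : ι → ℕ) (N k : ℤ) :
    binom N k - doubleSum M t N k = ∑ j ∈ range (∑ s ∈ M, t s + 1),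
      choiceSum M t j * binom (N - ∑ s ∈ M, t s) (k - j) := by
  have vandermonde := sum_choose_mul_binom (∑ s ∈ M, t s) (N - ↑(∑ s ∈ M, t s)) k
  rw [sub_add_cancel] at vandermonde
  simp only [doubleSum_eq_sum_binom, sub_mul, sum_sub_distrib, vandermonde, sub_sub_cancel]

lemma binom_sub_doubleSum_of_neg (M : Finset ι) (t : ι → ℕ) (N : ℤ) {k : ℤ} (hk : k < 0) :
    binom N k - doubleSum M t N k = 0 := by
  rw [binom_sub_doubleSum]
  exact sum_eq_zero fun j _ => by rw [binom_of_neg _ (by lia), mul_zero]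

lemma sum_add_card_filter_two_le {Q : Finset ι} {t : ι → ℕ} (ht : ∀ s ∈ Q, 1 ≤ t s) :
    ∑ s ∈ Q, t s + #{s ∈ Q | 2 ≤ t s} = #Q + ∑ s ∈ Q with 2 ≤ t s, t s := by
  rw [card_filter, sum_filter, card_eq_sum_ones, ← sum_add_distrib, ← sum_add_distrib]
  refine sum_congr rfl fun s hs => ?_
  have := ht s hs
  split_ifs <;> lia

theorem choiceSum_eq_binom_sub_doubleSum {Q : Finset ι} {t : ι → ℕ} (ht : ∀ s ∈ Q, 1 ≤ t s)
    (k : ℕ) :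
    choiceSum Q t k = binom (∑ s ∈ Q, (t s : ℤ)) k
      - doubleSum {s ∈ Q | 2 ≤ t s} t (∑ s ∈ Q, (t s : ℤ)) k := by
  classical
  set M := {s ∈ Q | 2 ≤ t s} with hM
  set L := {s ∈ Q | ¬ 2 ≤ t s} with hL
  have ht_one : ∀ s ∈ L, t s = 1 := fun s hs => by
    have := ht s (mem_filter.1 hs).1
    have := (mem_filter.1 hs).2
    lia
  have card_le : #M ≤ ∑ s ∈ M, t s :=
    card_eq_sum_ones M ▸ sum_le_sum fun s hs => ht s (mem_filter.1 hs).1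
  have card_rest : ∑ s ∈ Q, (t s : ℤ) - ↑(∑ s ∈ M, t s) = #L := by
    rw [← Nat.cast_sum, ← sum_filter_add_sum_filter_not Q (2 ≤ t ·) t, ← hM, ← hL,
      sum_congr rfl ht_one, ← card_eq_sum_ones, Nat.cast_add, add_sub_cancel_left]
  have split : choiceSum Q t k = ∑ j ∈ range (k + 1), choiceSum M t j * binom #L (k - j) := by
    rw [← filter_union_filter_not_eq (2 ≤ t ·) Q, choiceSum_union (disjoint_filter_filter_not ..),
      Nat.sum_antidiagonal_eq_sum_range_succ fun i j => choiceSum M t i * choiceSum L t j]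
    refine sum_congr rfl fun j hj => ?_
    rw [choiceSum_of_forall_eq_one ht_one, ← binom_natCast,
      Nat.cast_sub (Nat.lt_succ_iff.1 (mem_range.1 hj))]
  rw [binom_sub_doubleSum, card_rest, split]
  refine (sum_subset (range_subset_range.2 (Nat.le_add_right (k + 1) (∑ s ∈ M, t s)))
    fun j _ hj => ?_).trans
    (sum_subset (range_subset_range.2 (by lia)) fun j _ hj => ?_).symm
  · rw [mem_range] at hj
    rw [binom_of_neg _ (by lia), mul_zero]
  · rw [mem_range] at hj
    rw [choiceSum_of_card_lt t (by lia), zero_mul]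

open Classical in
lemma sum_powersetCard_filter_superset {Q D : Finset ι} (hD : D ⊆ Q) (t : ι → ℕ) {k : ℕ}
    (hk : #D ≤ k) :
    ∑ S ∈ Q.powersetCard k with D ⊆ S, ∏ s ∈ S, (t s : ℤ)
      = (∏ s ∈ D, (t s : ℤ)) * choiceSum (Q \ D) t (k - #D) := by
  rw [choiceSum, mul_sum]
  refine sum_nbij' (· \ D) (D ∪ ·) (fun S hS => ?_) (fun S hS => ?_) (fun S hS => ?_)
    (fun S hS => ?_) fun S hS => ?_ <;>
    simp only [mem_filter, mem_powersetCard, subset_sdiff] at hS ⊢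
  · exact ⟨⟨sdiff_subset.trans hS.1.1, sdiff_disjoint⟩, by rw [card_sdiff_of_subset hS.2, hS.1.2]⟩
  · refine ⟨⟨union_subset hD hS.1.1, ?_⟩, subset_union_left⟩
    rw [card_union_of_disjoint hS.1.2.symm, hS.2, Nat.add_sub_cancel' hk]
  · exact union_sdiff_of_subset hS.2
  · exact union_sdiff_cancel_left hS.1.2.symm
  · rw [mul_comm, prod_sdiff hS.2]

open Classical in
theorem faceFormula_eq_sum {Q D : Finset ι} (hD : D ⊆ Q) {t : ι → ℕ}
    (ht : ∀ s ∈ Q, 1 ≤ t s) (i : ℕ) :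
    faceFormula (∑ s ∈ Q, t s) #D {s ∈ D | 2 ≤ t s} {s ∈ Q \ D | 2 ≤ t s} t i
      = ∑ S ∈ Q.powersetCard (i + 1) with ¬ D ⊆ S, ∏ s ∈ S, (t s : ℤ) := by
  have prod_multiple : ∏ s ∈ D with 2 ≤ t s, (t s : ℤ) = ∏ s ∈ D, (t s : ℤ) :=
    prod_filter_of_ne fun s hs hne => by
      have := ht s (hD hs)
      rw [Ne, Nat.cast_eq_one] at hne
      lia
  have sum_outside : ((∑ s ∈ Q, t s : ℕ) : ℤ) - ∑ s ∈ D with 2 ≤ t s, (t s : ℤ)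
      + #{s ∈ D | 2 ≤ t s} - #D = ∑ s ∈ Q \ D, (t s : ℤ) := by
    have absorb := sum_add_card_filter_two_le fun s hs => ht s (hD hs)
    rw [← sum_sdiff hD, ← Nat.cast_sum, ← Nat.cast_sum]
    lia
  have supersets : ∑ S ∈ Q.powersetCard (i + 1) with D ⊆ S, ∏ s ∈ S, (t s : ℤ)
      = (∏ s ∈ D, (t s : ℤ)) * (binom (∑ s ∈ Q \ D, (t s : ℤ)) (i + 1 - #D)
        - doubleSum {s ∈ Q \ D | 2 ≤ t s} t (∑ s ∈ Q \ D, (t s : ℤ)) (i + 1 - #D)) := by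
    rcases le_or_gt #D (i + 1) with hcard | hcard
    · rw [sum_powersetCard_filter_superset hD t hcard,
        choiceSum_eq_binom_sub_doubleSum fun s hs => ht s (mem_sdiff.1 hs).1,
        Nat.cast_sub hcard, Nat.cast_add_one]
    · rw [binom_sub_doubleSum_of_neg _ _ _ (by lia), mul_zero]
      refine sum_eq_zero fun S hS => ?_
      obtain ⟨hSQ, hDS⟩ := mem_filter.1 hS
      exact absurd ((mem_powersetCard.1 hSQ).2 ▸ card_le_card hDS) hcard.not_ge
  rw [faceFormula, prod_multiple, sum_outside, ← supersets, ← filter_union,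
    union_sdiff_of_subset hD, sub_right_comm, sub_eq_iff_eq_add', sum_filter_add_sum_filter_not,
    Nat.cast_sum, ← Nat.cast_add_one, ← choiceSum_eq_binom_sub_doubleSum ht, choiceSum]

end FaceFormula

/-! ### Sets of representatives of the fibres of a map -/

section Complex

variable {ε P : Type*}

lemma faceNumber_eq_zero {K : PreAbstractSimplicialComplex ε} {i : ℕ}
    (h : ∀ F ∈ K.faces, #F ≠ i + 1) : K.faceNumber i = 0 := by
  have no_face : {F | F ∈ K.faces ∧ #F = i + 1} = ∅ :=
    Set.eq_empty_of_forall_notMem fun F hF => h F hF.1 hF.2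
  rw [PreAbstractSimplicialComplex.faceNumber, no_face, Set.ncard_empty]

lemma eulerChar_eq_sum_range {K : PreAbstractSimplicialComplex ε} {N : ℕ}
    (hN : ∀ F ∈ K.faces, #F ≤ N) :
    K.eulerChar = ∑ i ∈ range N, (-1) ^ i * (K.faceNumber i : ℤ) := by
  have card_le_dim (F) (hF : F ∈ K.faces) : (#F : ℤ) ≤ K.dim + 1 := by
    have bdd : BddAbove K.faceDims := ⟨N - 1, by
      rintro _ ⟨F, hF, rfl⟩
      have := hN F hF
      lia⟩
    exact sub_le_iff_le_add.1 (le_csSup bdd ⟨F, hF, rfl⟩)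
  rw [PreAbstractSimplicialComplex.eulerChar]
  refine (sum_subset (range_subset_range.2 (le_max_left _ N)) fun i _ hi => ?_).trans
    (sum_subset (range_subset_range.2 (le_max_right _ _)) fun i _ hi => ?_).symm
  all_goals
    rw [mem_range] at hi
    rw [faceNumber_eq_zero fun F hF => ?_, Nat.cast_zero, mul_zero]
  · have := card_le_dim F hF
    lia
  · have := hN F hF
    lia

/-- The complex of the nonempty finite subsets of `E` that meet each fibre of `f` at most once and
miss some fibre over `D`. For the map sending an edge to its pair of ends and the set `D` of
pairs on the cycle, this will be the spanning complex of a uni-cyclic multigraph. -/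
def transversalComplex (f : ε → P) (E : Set ε) (D : Set P) : PreAbstractSimplicialComplex ε where
  faces := {F | F.Nonempty ∧ (F : Set ε) ⊆ E ∧ Set.InjOn f F ∧ ¬ D ⊆ f '' F}
  isRelLowerSet_faces := by
    rintro F ⟨hF, hFE, hinj, hD⟩
    refine ⟨hF, fun F' hle hF' => ⟨hF', (coe_subset.2 hle).trans hFE, hinj.mono hle, ?_⟩⟩
    exact fun h => hD (h.trans (Set.image_mono hle))

lemma mem_faces_transversalComplex {f : ε → P} {E : Set ε} {D : Set P} {F : Finset ε} :
    F ∈ (transversalComplex f E D).faces ↔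
      F.Nonempty ∧ (F : Set ε) ⊆ E ∧ Set.InjOn f F ∧ ¬ D ⊆ f '' F :=
  Iff.rfl

open Classical in
lemma card_injOn_image_eq (f : ε → P) (E : Finset ε) (S : Finset P) :
    #(E.powerset.filter fun F : Finset ε => Set.InjOn f F ∧ F.image f = S)
      = ∏ s ∈ S, #{e ∈ E | f e = s} := by
  rw [← card_pi]
  refine (card_bij (fun g _ => S.attach.image fun s => g s s.2) (fun g hg => ?_)
    (fun g hg h hh hgh => ?_) fun F hF => ?_).symm
  · simp only [mem_pi, mem_filter] at hg
    refine mem_filter.2 ⟨mem_powerset.2 (image_subset_iff.2 fun s _ => (hg s s.2).1), ?_, ?_⟩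
    · rw [coe_image]
      rintro _ ⟨s, -, rfl⟩ _ ⟨u, -, rfl⟩ hsu
      rw [(hg s s.2).2, (hg u u.2).2] at hsu
      rw [Subtype.ext hsu]
    · rw [image_image, image_congr (g := Subtype.val) fun s _ => (hg s s.2).2,
        attach_image_val]
  · simp only [mem_pi, mem_filter] at hg hh
    funext s hs
    obtain ⟨u, -, hu⟩ := mem_image.1 (hgh ▸ mem_image_of_mem _ (mem_attach S ⟨s, hs⟩))
    obtain rfl : u = ⟨s, hs⟩ :=
      Subtype.ext (by rw [← (hh u u.2).2, hu, (hg s hs).2])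
    exact hu.symm
  · obtain ⟨hFE, hinj, rfl⟩ := mem_filter.1 hF
    choose g hgF hg using fun s (hs : s ∈ F.image f) => mem_image.1 hs
    refine ⟨g, mem_pi.2 fun s hs => mem_filter.2 ⟨mem_powerset.1 hFE (hgF s hs), hg s hs⟩, ?_⟩
    ext e
    refine ⟨fun he => ?_, fun he => ?_⟩
    · obtain ⟨s, -, rfl⟩ := mem_image.1 he
      exact hgF s s.2
    · exact mem_image.2 ⟨⟨f e, mem_image_of_mem f he⟩, mem_attach _ _, hinj (hgF _ _) he (hg _ _)⟩

open Classical in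
lemma faceNumber_transversalComplex (f : ε → P) (E : Finset ε) (D : Finset P) (i : ℕ) :
    (transversalComplex f E D).faceNumber i
      = ∑ S ∈ (E.image f).powersetCard (i + 1) with ¬ D ⊆ S, ∏ s ∈ S, #{e ∈ E | f e = s} := by
  have faces_eq : {F | F ∈ (transversalComplex f E D).faces ∧ #F = i + 1}
      = (E.powerset.filter fun F : Finset ε => (Set.InjOn f F ∧ ¬ D ⊆ F.image f) ∧ #F = i + 1) := by
    ext F
    have nonempty (h : #F = i + 1) : F.Nonempty := card_pos.1 (by lia)
    simp only [Set.mem_ofPred_eq, mem_faces_transversalComplex, coe_filter, mem_powerset,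
      ← coe_subset, coe_image]
    tauto
  rw [PreAbstractSimplicialComplex.faceNumber, faces_eq, Set.ncard_coe_finset,
    card_eq_sum_card_fiberwise (f := image f)
      (t := {S ∈ (E.image f).powersetCard (i + 1) | ¬ D ⊆ S})]
  · refine sum_congr rfl fun S hS => ?_
    obtain ⟨hSE, hDS⟩ := mem_filter.1 hS
    rw [← card_injOn_image_eq, filter_filter]
    congr 1
    refine filter_congr fun F _ => ⟨fun h => ⟨h.1.1.1, h.2⟩, ?_⟩
    rintro ⟨hinj, rfl⟩
    exact ⟨⟨⟨hinj, hDS⟩, card_image_of_injOn hinj ▸ (mem_powersetCard.1 hSE).2⟩, rfl⟩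
  · intro F hF
    obtain ⟨hFE, ⟨hinj, hD⟩, hcard⟩ := mem_filter.1 hF
    exact mem_filter.2 ⟨mem_powersetCard.2 ⟨image_subset_image (mem_powerset.1 hFE),
      card_image_of_injOn hinj ▸ hcard⟩, hD⟩

lemma isGreatest_faceDims_transversalComplex [DecidableEq P] {f : ε → P} {E : Finset ε}
    {D : Finset P} (hD : D.Nonempty) (hDE : D ⊆ E.image f) (hE : 2 ≤ #(E.image f)) :
    IsGreatest (transversalComplex f E D).faceDims (#(E.image f) - 2) := by
  constructor
  · obtain ⟨p, hp⟩ := hD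
    have surjOn : Set.SurjOn f E ((E.image f).erase p : Finset P) :=
      (coe_image (f := f) ▸ Set.surjOn_image f E).mono le_rfl (coe_subset.2 (erase_subset _ _))
    obtain ⟨F, hFE, hinj, himage⟩ := exists_subset_injOn_image_eq_of_surjOn _ _ surjOn
    have card_eq : #F = #(E.image f) - 1 := by
      rw [← card_image_of_injOn hinj, himage, card_erase_of_mem (hDE hp)]
    refine ⟨F, ⟨card_pos.1 (by lia), hFE, hinj, fun h => ?_⟩, by lia⟩
    rw [← coe_image, himage] at h
    exact notMem_erase p _ (h hp)
  · rintro _ ⟨F, ⟨-, hFE, hinj, hDF⟩, rfl⟩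
    have image_ssubset : F.image f ⊂ E.image f := by
      refine ⟨image_subset_image hFE, fun h => hDF ?_⟩
      rw [← coe_image, coe_subset]
      exact hDE.trans h
    have := card_lt_card image_ssubset
    rw [card_image_of_injOn hinj] at this
    lia

lemma one_le_card_fiber [DecidableEq P] {f : ε → P} {E : Finset ε} :
    ∀ s ∈ E.image f, 1 ≤ #{e ∈ E | f e = s} := by
  intro s hs
  obtain ⟨e, he, rfl⟩ := mem_image.1 hs
  exact card_pos.2 ⟨e, mem_filter.2 ⟨he, rfl⟩⟩

theorem faceNumber_transversalComplex_eq_faceFormula [DecidableEq P] {f : ε → P} {E : Finset ε}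
    {D : Finset P} (hD : D ⊆ E.image f) {t : P → ℕ} (ht : ∀ s, t s = #{e ∈ E | f e = s}) (i : ℕ) :
    ((transversalComplex f E D).faceNumber i : ℤ)
      = faceFormula #E #D {s ∈ D | 2 ≤ t s} {s ∈ E.image f \ D | 2 ≤ t s} t i := by
  obtain rfl : t = fun s => #{e ∈ E | f e = s} := funext ht
  -- `faceFormula` is defined with the classical decidability of equality
  obtain rfl : ‹DecidableEq P› = fun _ _ => Classical.propDecidable _ := Subsingleton.elim _ _
  classical
  rw [faceNumber_transversalComplex, card_eq_sum_card_image f E,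
    faceFormula_eq_sum hD one_le_card_fiber, Nat.cast_sum]
  exact sum_congr rfl fun S _ => Nat.cast_prod _ _

end Complex

/-! ### Forests in a uni-cyclic multigraph -/

section UniqueCycle

variable {W : Type*} {K H : SimpleGraph W} {v : W} {c : K.Walk v v}

lemma isAcyclic_iff_of_unique_cycle (hHK : H ≤ K) (hc : c.IsCycle)
    (unique : ∀ (w : W) (d : K.Walk w w), d.IsCycle → ∀ p, p ∈ d.edges ↔ p ∈ c.edges) :
    H.IsAcyclic ↔ ¬ {p | p ∈ c.edges} ⊆ H.edgeSet := by
  refine ⟨fun hH hcH => hH _ (hc.transfer hcH), fun hcH w d hd => hcH fun p hp => ?_⟩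
  rw [Set.mem_ofPred_eq, ← unique w _ (hd.mapLe hHK), SimpleGraph.Walk.edges_mapLe_eq_edges] at hp
  exact d.edges_subset_edgeSet hp

end UniqueCycle

section EndPair

variable {V ε : Type*} (G : Graph V ε)

lemma exists_mem_bundle {e : ε} (he : e ∈ G.edgeSet) : ∃ p, e ∈ G.bundle p := by
  obtain ⟨x, y, h⟩ := G.exists_isLink_of_mem_edgeSet he
  exact ⟨_, ⟨x, h.left_mem⟩, ⟨y, h.right_mem⟩, rfl, h⟩

variable {G}

lemma cyclePairs_eq_of_unique_cycle {v : G.vertexSet} {c : G.toSimpleGraph.Walk v v}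
    (hc : c.IsCycle) (unique : ∀ (w : G.vertexSet) (d : G.toSimpleGraph.Walk w w), d.IsCycle →
      ∀ p : Sym2 G.vertexSet, p ∈ d.edges ↔ p ∈ c.edges) :
    G.cyclePairs = {p | p ∈ c.edges} :=
  Set.ext fun p => ⟨fun ⟨w, d, hd, hp⟩ => (unique w d hd p).1 hp, fun hp => ⟨v, c, hc, hp⟩⟩

lemma cyclePairs_subset_edgeSet : G.cyclePairs ⊆ G.toSimpleGraph.edgeSet := by
  rintro p ⟨v, c, -, hp⟩
  exact c.edges_subset_edgeSet hp

lemma eq_of_mem_bundle {e : ε} {p q : Sym2 G.vertexSet} (hp : e ∈ G.bundle p)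
    (hq : e ∈ G.bundle q) : p = q := by
  obtain ⟨x, y, rfl, h⟩ := hp
  obtain ⟨x', y', rfl, h'⟩ := hq
  rw [Sym2.eq_iff]
  simpa only [Subtype.ext_iff] using h.eq_and_eq_or_eq_and_eq h'

lemma mem_bundle_mk {e : ε} {x y : G.vertexSet} :
    e ∈ G.bundle s(x, y) ↔ G.IsLink e x y := by
  refine ⟨?_, fun h => ⟨x, y, rfl, h⟩⟩
  rintro ⟨x', y', hxy, h⟩
  rcases Sym2.eq_iff.1 hxy with ⟨rfl, rfl⟩ | ⟨rfl, rfl⟩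
  exacts [h, h.symm]

lemma restrict_edgeSet_of_isSpanningSubgraph {T : Graph V ε} (hT : T.IsSpanningSubgraph G) :
    G.restrict T.edgeSet = T :=
  (Graph.Compatible.of_le_le Graph.restrict_le hT.le).ext hT.vertexSet_eq.symm
    (Set.inter_eq_right.2 hT.le.edgeSet_mono)

instance nonempty_sym2 {W : Type*} [Nonempty W] : Nonempty (Sym2 W) := .map Sym2.diag ‹_›

variable (G) [Nonempty G.vertexSet]

/-- The pair of ends of an edge of `G`; its value is arbitrary outside `G.edgeSet`. -/
noncomputable def endPair (e : ε) : Sym2 G.vertexSet :=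
  Classical.epsilon fun p => e ∈ G.bundle p

variable {G}

lemma mem_bundle_endPair {e : ε} (he : e ∈ G.edgeSet) : e ∈ G.bundle (endPair G e) :=
  Classical.epsilon_spec (p := fun p => e ∈ G.bundle p) (exists_mem_bundle G he)

lemma mem_bundle_iff {e : ε} {p : Sym2 G.vertexSet} :
    e ∈ G.bundle p ↔ e ∈ G.edgeSet ∧ endPair G e = p := by
  constructor
  · intro h
    have he : e ∈ G.edgeSet := by
      obtain ⟨x, y, -, hlink⟩ := h
      exact hlink.edge_mem
    exact ⟨he, eq_of_mem_bundle (mem_bundle_endPair he) h⟩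
  · rintro ⟨he, rfl⟩
    exact mem_bundle_endPair he

lemma isLink_iff_endPair_eq {e : ε} {x y : G.vertexSet} :
    G.IsLink e x y ↔ e ∈ G.edgeSet ∧ endPair G e = s(x, y) := by
  rw [← mem_bundle_mk, mem_bundle_iff]

lemma multipleEdges_subset : G.multipleEdges ⊆ endPair G '' G.edgeSet := by
  intro p hp
  have two_le : 2 ≤ (G.bundle p).ncard := hp
  obtain ⟨e, he⟩ := Set.nonempty_of_ncard_ne_zero (s := G.bundle p) (by lia)
  exact ⟨e, mem_bundle_iff.1 he⟩

lemma toSimpleGraph_restrict {X : Set ε} (hX : X ⊆ G.edgeSet) :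
    ((G.restrict X).toSimpleGraph : SimpleGraph G.vertexSet)
      = SimpleGraph.fromEdgeSet (endPair G '' X) := by
  refine SimpleGraph.ext (funext₂ fun (u v : G.vertexSet) => propext ?_)
  rw [SimpleGraph.fromEdgeSet_adj]
  change (u ≠ v ∧ ∃ e ∈ X, G.IsLink e u v) ↔ _
  rw [and_comm]
  refine and_congr_left fun _ => exists_congr fun e => and_congr_right fun he => ?_
  rw [isLink_iff_endPair_eq, and_iff_right (hX he)]

lemma edgeSet_toSimpleGraph [G.Loopless] :
    G.toSimpleGraph.edgeSet = endPair G '' G.edgeSet := by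
  ext p
  induction p with | h u v
  rw [SimpleGraph.mem_edgeSet, G.toSimpleGraph_adj_iff]
  exact exists_congr fun e => isLink_iff_endPair_eq

lemma edgeSet_fromEdgeSet_image_endPair [G.Loopless] {X : Set ε} (hX : X ⊆ G.edgeSet) :
    (SimpleGraph.fromEdgeSet (endPair G '' X)).edgeSet = endPair G '' X := by
  rw [SimpleGraph.edgeSet_fromEdgeSet, sdiff_eq_left, Set.disjoint_left]
  intro p hp
  have hpG : p ∈ G.toSimpleGraph.edgeSet := edgeSet_toSimpleGraph (G := G) ▸ Set.image_mono hX hp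
  exact G.toSimpleGraph.not_isDiag_of_mem_edgeSet hpG

lemma fromEdgeSet_image_endPair_le [G.Loopless] {X : Set ε} (hX : X ⊆ G.edgeSet) :
    SimpleGraph.fromEdgeSet (endPair G '' X) ≤ G.toSimpleGraph := by
  rw [← SimpleGraph.edgeSet_subset_edgeSet, edgeSet_fromEdgeSet_image_endPair hX,
    edgeSet_toSimpleGraph]
  exact Set.image_mono hX

lemma simple_restrict_iff [G.Loopless] {X : Set ε} (hX : X ⊆ G.edgeSet) :
    (G.restrict X).Simple ↔ Set.InjOn (endPair G) X := by
  constructor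
  · intro hsimple e he f hf hef
    obtain ⟨⟨x, y⟩, h⟩ := exists_mem_bundle G (hX he)
    have hfxy : endPair G f = s(x, y) := hef ▸ (mem_bundle_iff.1 h).2
    exact hsimple.eq_of_isLink (x := x) (y := y) ⟨he, mem_bundle_mk.1 h⟩
      ⟨hf, isLink_iff_endPair_eq.2 ⟨hX hf, hfxy⟩⟩
  · intro hinj
    have : (G.restrict X).Loopless := .anti Graph.restrict_le
    refine ⟨fun e f x y he hf => hinj he.1 hf.1 ?_⟩
    lift x to G.vertexSet using he.2.left_mem
    lift y to G.vertexSet using he.2.right_mem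
    rw [(isLink_iff_endPair_eq.1 he.2).2, (isLink_iff_endPair_eq.1 hf.2).2]

lemma isSpanningTree_restrict_iff [G.Loopless] {X : Set ε} (hX : X ⊆ G.edgeSet) :
    (G.restrict X).IsSpanningTree G ↔
      Set.InjOn (endPair G) X ∧ (SimpleGraph.fromEdgeSet (endPair G '' X)).IsTree := by
  have spanning : (G.restrict X).IsSpanningSubgraph G := ⟨Graph.restrict_le, rfl⟩
  rw [← simple_restrict_iff hX, ← toSimpleGraph_restrict hX]
  exact and_iff_right spanning

lemma mem_faces_spanningComplex [G.Loopless] (hG : G.toSimpleGraph.Connected) {F : Finset ε} :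
    F ∈ G.spanningComplex.faces ↔ F.Nonempty ∧ (F : Set ε) ⊆ G.edgeSet ∧
      Set.InjOn (endPair G) F ∧ (SimpleGraph.fromEdgeSet (endPair G '' F)).IsAcyclic := by
  refine and_congr_right fun _ => ⟨?_, ?_⟩
  · rintro ⟨T, hT, hFT⟩
    have hTG : T.edgeSet ⊆ G.edgeSet := hT.1.le.edgeSet_mono
    rw [← restrict_edgeSet_of_isSpanningSubgraph hT.1, isSpanningTree_restrict_iff hTG] at hT
    exact ⟨hFT.trans hTG, hT.1.mono hFT,
      hT.2.isAcyclic.anti (SimpleGraph.fromEdgeSet_mono (Set.image_mono hFT))⟩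
  · rintro ⟨hFG, hinj, hacyclic⟩
    obtain ⟨H, hFH, hHG, hH⟩ := hG.exists_isTree_le_of_le_of_isAcyclic
      (fromEdgeSet_image_endPair_le hFG) hacyclic
    rw [← SimpleGraph.edgeSet_subset_edgeSet, edgeSet_fromEdgeSet_image_endPair hFG] at hFH
    rw [← SimpleGraph.edgeSet_subset_edgeSet, edgeSet_toSimpleGraph] at hHG
    obtain ⟨X, hFX, hXG, hX⟩ := hinj.bijOn_image.exists_extend_of_subset hFG hFH hHG
    refine ⟨G.restrict X, (isSpanningTree_restrict_iff hXG).2 ⟨hX.injOn, ?_⟩,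
      fun e he => ⟨hXG (hFX he), hFX he⟩⟩
    rwa [hX.image_eq, SimpleGraph.fromEdgeSet_edgeSet]

end EndPair

section Unicyclic

variable {V ε : Type*} {G : Graph V ε} {n r m : ℕ}

lemma inside_eq_filter {D M' : Finset (Sym2 G.vertexSet)} (hD : D = G.cyclePairs)
    (hM' : M' = G.multipleEdges ∩ G.cyclePairs) : M' = {p ∈ D | 2 ≤ G.mult p} := by
  rw [← coe_inj, hM', coe_filter, ← hD, Set.inter_comm]
  rfl

lemma ncard_cyclePairs (hG : G.IsUnicyclicMultigraph n r m) : G.cyclePairs.ncard = m := by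
  classical
  obtain ⟨v, c, hc, hm, unique⟩ := hG.unique_cycle
  rw [cyclePairs_eq_of_unique_cycle hc unique, ← List.coe_toFinset, Set.ncard_coe_finset,
    List.toFinset_card_of_nodup hc.edges_nodup, SimpleGraph.Walk.length_edges, hm]

lemma three_le_length (hG : G.IsUnicyclicMultigraph n r m) : 3 ≤ m := by
  obtain ⟨v, c, hc, rfl, -⟩ := hG.unique_cycle
  exact hc.three_le_length

lemma spanningComplex_eq [Nonempty G.vertexSet] (hG : G.IsUnicyclicMultigraph n r m) :
    G.spanningComplex = transversalComplex (endPair G) G.edgeSet G.cyclePairs := by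
  have := hG.loopless
  obtain ⟨v, c, hc, -, unique⟩ := hG.unique_cycle
  refine PreAbstractSimplicialComplex.ext (Set.ext fun F => ?_)
  rw [mem_faces_spanningComplex hG.connected, mem_faces_transversalComplex]
  refine and_congr_right fun _ => and_congr_right fun hF => and_congr_right fun _ => ?_
  rw [isAcyclic_iff_of_unique_cycle (fromEdgeSet_image_endPair_le hF) hc unique,
    edgeSet_fromEdgeSet_image_endPair hF, cyclePairs_eq_of_unique_cycle hc unique]

section Finite

variable [Nonempty G.vertexSet] {E : Finset ε} {M' M'' : Finset (Sym2 G.vertexSet)}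

open Classical in
lemma mult_eq_card_fiber (hE : E = G.edgeSet) (p : Sym2 G.vertexSet) :
    G.mult p = #{e ∈ E | endPair G e = p} := by
  rw [Graph.mult, ← Set.ncard_coe_finset]
  congr 1
  ext e
  rw [mem_bundle_iff, coe_filter, Set.mem_ofPred_eq, ← hE, mem_coe]

open Classical in
lemma coe_filter_two_le_mult (hE : E = G.edgeSet) :
    ({p ∈ E.image (endPair G) | 2 ≤ G.mult p} : Finset _) = G.multipleEdges := by
  rw [coe_filter, ← Set.inter_eq_right.2 (multipleEdges_subset (G := G)), ← hE, ← coe_image]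
  rfl

open Classical in
lemma outside_eq_filter (hE : E = G.edgeSet) {D : Finset (Sym2 G.vertexSet)}
    (hD : D = G.cyclePairs) (hM'' : M'' = G.multipleEdges \ G.cyclePairs) :
    M'' = {p ∈ E.image (endPair G) \ D | 2 ≤ G.mult p} := by
  rw [← coe_inj, hM'', ← coe_filter_two_le_mult hE, ← hD, ← coe_sdiff, coe_inj]
  ext p
  simp only [mem_filter, mem_sdiff]
  exact and_right_comm

open Classical in
lemma card_image_endPair (hG : G.IsUnicyclicMultigraph n r m) (hE : E = G.edgeSet)
    (hM' : M' = G.multipleEdges ∩ G.cyclePairs) (hM'' : M'' = G.multipleEdges \ G.cyclePairs) :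
    (#(E.image (endPair G)) : ℤ)
      = n - (∑ p ∈ M', (G.mult p : ℤ)) - (∑ p ∈ M'', (G.mult p : ℤ)) + r := by
  have union_eq : M' ∪ M'' = {p ∈ E.image (endPair G) | 2 ≤ G.mult p} := by
    rw [← coe_inj, coe_filter_two_le_mult hE, coe_union, hM', hM'', Set.inter_union_sdiff]
  have disjoint : Disjoint M' M'' := by
    rw [← disjoint_coe, hM', hM'']
    exact Set.disjoint_sdiff_right.mono_left Set.inter_subset_right
  have sum_mult : ∑ p ∈ E.image (endPair G), G.mult p = n := by
    simp only [mult_eq_card_fiber hE]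
    rw [← card_eq_sum_card_image, ← hG.ncard_edgeSet, ← hE, Set.ncard_coe_finset]
  have card_union : #(M' ∪ M'') = r := by
    rw [← hG.ncard_multipleEdges, ← Set.ncard_coe_finset, coe_union, hM', hM'',
      Set.inter_union_sdiff]
  have absorb := sum_add_card_filter_two_le (Q := E.image (endPair G)) (t := G.mult)
    (by simpa only [mult_eq_card_fiber hE] using one_le_card_fiber)
  rw [← union_eq, card_union, sum_mult, sum_union disjoint] at absorb
  rw [← Nat.cast_sum, ← Nat.cast_sum]
  lia

open Classical in
lemma exists_finset_eq_cyclePairs (hG : G.IsUnicyclicMultigraph n r m) (hE : E = G.edgeSet) :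
    ∃ D : Finset (Sym2 G.vertexSet), D = G.cyclePairs ∧ D ⊆ E.image (endPair G) ∧ #D = m := by
  have := hG.loopless
  have subset_image : G.cyclePairs ⊆ E.image (endPair G) := by
    rw [coe_image, hE, ← edgeSet_toSimpleGraph]
    exact cyclePairs_subset_edgeSet
  obtain ⟨D, hD⟩ := ((finite_toSet _).subset subset_image).exists_finset_coe
  exact ⟨D, hD, by rwa [← coe_subset, hD],
    by rw [← ncard_cyclePairs hG, ← hD, Set.ncard_coe_finset]⟩

open Classical in
theorem isGreatest_faceDims_spanningComplex (hG : G.IsUnicyclicMultigraph n r m)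
    (hE : E = G.edgeSet) :
    IsGreatest G.spanningComplex.faceDims (#(E.image (endPair G)) - 2) := by
  obtain ⟨D, hD, hDE, card_D⟩ := exists_finset_eq_cyclePairs hG hE
  have := three_le_length hG
  have := card_le_card hDE
  rw [spanningComplex_eq hG, ← hE, ← hD]
  exact isGreatest_faceDims_transversalComplex (card_pos.1 (by lia)) hDE (by lia)

theorem faceNumber_spanningComplex (hG : G.IsUnicyclicMultigraph n r m)
    (hM' : M' = G.multipleEdges ∩ G.cyclePairs) (hM'' : M'' = G.multipleEdges \ G.cyclePairs)
    (i : ℕ) : (G.spanningComplex.faceNumber i : ℤ) = faceFormula n m M' M'' G.mult i := by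
  classical
  obtain ⟨E, hE⟩ := hG.finite.exists_finset_coe
  obtain ⟨D, hD, hDE, card_D⟩ := exists_finset_eq_cyclePairs hG hE
  have card_E : #E = n := by rw [← hG.ncard_edgeSet, ← hE, Set.ncard_coe_finset]
  have complex_eq : G.spanningComplex = transversalComplex (endPair G) E D := by
    rw [spanningComplex_eq hG, hE, hD]
  rw [complex_eq, inside_eq_filter hD hM', outside_eq_filter hE hD hM'', ← card_E, ← card_D]
  exact faceNumber_transversalComplex_eq_faceFormula hDE (mult_eq_card_fiber hE) i

lemma card_le_of_mem_faces (hG : G.IsUnicyclicMultigraph n r m) {F : Finset ε}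
    (hF : F ∈ G.spanningComplex.faces) : #F ≤ n := by
  rw [spanningComplex_eq hG] at hF
  rw [← hG.ncard_edgeSet, ← Set.ncard_coe_finset]
  exact Set.ncard_le_ncard hF.2.1 hG.finite

end Finite

end Unicyclic

end SpanningComplexFormula

open Finset SpanningComplexFormula

theorem theorem3p3 {V ε : Type*} (G : Graph V ε) (n r m : ℕ)
    (hG : G.IsUnicyclicMultigraph n r m)
    (M' M'' : Finset (Sym2 G.vertexSet))
    (hM' : (M' : Set (Sym2 G.vertexSet)) = G.multipleEdges ∩ G.cyclePairs)
    (hM'' : (M'' : Set (Sym2 G.vertexSet)) = G.multipleEdges \ G.cyclePairs) :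
    IsGreatest G.spanningComplex.faceDims G.spanningComplex.dim ∧
    G.spanningComplex.dim
      = (n : ℤ) - (∑ p ∈ M', (G.mult p : ℤ)) - (∑ p ∈ M'', (G.mult p : ℤ)) + r - 2 ∧
    (∀ i : ℕ, (G.spanningComplex.faceNumber i : ℤ)
      = SpanningComplexFormula.faceFormula n m M' M'' G.mult i) ∧
    G.spanningComplex.eulerChar
      = ∑ i ∈ Finset.range n,
          (-1) ^ i * SpanningComplexFormula.faceFormula n m M' M'' G.mult i := by
  classical
  have := hG.connected.nonempty
  obtain ⟨E, hE⟩ := hG.finite.exists_finset_coe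
  have greatest := isGreatest_faceDims_spanningComplex hG hE
  have dim_eq : G.spanningComplex.dim = #(E.image (endPair G)) - 2 := greatest.csSup_eq
  have faceNumber_eq := faceNumber_spanningComplex hG hM' hM''
  refine ⟨dim_eq ▸ greatest, by rw [dim_eq, card_image_endPair hG hE hM' hM''], faceNumber_eq, ?_⟩
  simp only [← faceNumber_eq]
  exact eulerChar_eq_sum_range fun F => card_le_of_mem_faces hG
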